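/- Let $n,m$ be integers with $2\le n\le |m|$, let $\Gamma:=\operatorname{BS}(n,m)=\langle a,b\mid ba^nb^{-1}=a^m\rangle$, and let $\Gamma\curvearrowright(X,\mu)$ be a probability measure preserving action on a standard probability space. Put $k=\gcd(n,m)$, $n_0=n/k$, $m_0=m/k$ and $$\mathcal F:=\{k\,|n_0|^s|m_0|^t \mid s,t\in\mathbb N=\{0,1,2,\dots\},\ s+t>0\}.$$ Let $\Lambda:=\operatorname{QC}_\Gamma(\langle a\rangle)=\bigcup_{L} \operatorname{C}_\Gamma(L)$ be the quasi-centralizer of $\langle a\rangle$, where $L$ runs over the finite index subgroups of $\langle a\rangle$ and $\operatorname{C}_\Gamma(L)$ is the centralizer of $L$ in $\Gamma$. Let $M:=L^\infty(X)\rtimes\Gamma$ be the crossed product von Neumann algebra and, for every nonzero integer $z$, let $N_z:=L^\infty(X)\rtimes\langle a^z\rangle\subset M$. The following statements are equivalent. 1. $N_z'\cap M=\mathbb C1$ for every $z\in\mathcal F$. 2. $\Lambda\curvearrowright X$ is essentially free and $\langle a^z\rangle\curvearrowright X$ is ergodic for every $z\in\mathcal F$. 3. $\Gamma\curvearrowright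 X$ is essentially free and $\langle a^z\rangle\curvearrowright X$ is ergodic for every $z\in\mathcal F$. Here an action of a subgroup of $\Gamma$ on $(X,\mu)$ is called essentially free if $\mu(\{x\in X\mid gx=x\})=0$ for every element $g\ne e$ of that subgroup. -/

import Mathlib

open MeasureTheory
open scoped ENNReal

/-- The Baumslag-Solitar group `BS(n, m) = ⟨a, b ∣ b aⁿ b⁻¹ = aᵐ⟩`; the free generator `0` is `a`
and the free generator `1` is `b`. -/
abbrev BaumslagSolitar (n m : ℤ) : Type :=
  PresentedGroup ({FreeGroup.of 1 * FreeGroup.of 0 ^ n * (FreeGroup.of 1)⁻¹ *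
    (FreeGroup.of 0 ^ m)⁻¹} : Set (FreeGroup (Fin 2)))

/-- The generator `a` of `BS(n, m)`. -/
def BaumslagSolitar.a (n m : ℤ) : BaumslagSolitar n m := PresentedGroup.of 0

/-- The set `𝓕 = {k |n₀|ˢ |m₀|ᵗ ∣ s, t ∈ ℕ, s + t > 0}`, where `k = gcd(n, m)`, `n₀ = n / k` and
`m₀ = m / k` (the divisions are exact). -/
def indexSet (n m : ℤ) : Set ℕ :=
  {z | ∃ s t : ℕ, 0 < s + t ∧
    z = Int.gcd n m * (n / (Int.gcd n m : ℤ)).natAbs ^ s * (m / (Int.gcd n m : ℤ)).natAbs ^ t}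

/-- The quasi-centralizer of a subgroup `L` of a group `G`: the union of the centralizers in `G`
of all finite index subgroups of `L`. -/
def quasiCentralizer {G : Type*} [Group G] (L : Subgroup G) : Subgroup G where
  carrier := {g | ∃ L₁ : Subgroup G, L₁ ≤ L ∧ L₁.relIndex L ≠ 0 ∧
    g ∈ Subgroup.centralizer (L₁ : Set G)}
  one_mem' := ⟨L, le_rfl, by simp, one_mem _⟩
  mul_mem' := by
    rintro g h ⟨L₁, h₁, i₁, c₁⟩ ⟨L₂, h₂, i₂, c₂⟩
    exact ⟨L₁ ⊓ L₂, inf_le_left.trans h₁, Subgroup.relIndex_inf_ne_zero i₁ i₂,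
      mul_mem (Subgroup.centralizer_le (fun _ hx => hx.1) c₁)
        (Subgroup.centralizer_le (fun _ hx => hx.2) c₂)⟩
  inv_mem' := by
    rintro g ⟨L₁, h₁, i₁, c₁⟩
    exact ⟨L₁, h₁, i₁, inv_mem c₁⟩

/-- An action of a (countable) group `G` on a measure space `(X, μ)` is essentially free if the
fixed point set of every nontrivial group element is a null set. -/
def EssentiallyFree (G : Type*) {X : Type*} [Group G] [MulAction G X] [MeasurableSpace X]
    (μ : Measure X) : Prop :=
  ∀ g : G, g ≠ 1 → μ (MulAction.fixedBy X g) = 0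

/-- The von Neumann algebra generated by a set `S` of bounded operators on a Hilbert space:
the double commutant of `S ∪ S*`. -/
noncomputable def generatedVonNeumannAlgebra {H : Type*} [NormedAddCommGroup H]
    [InnerProductSpace ℂ H] [CompleteSpace H] (S : Set (H →L[ℂ] H)) : VonNeumannAlgebra H where
  toStarSubalgebra :=
    StarSubalgebra.centralizer ℂ (StarSubalgebra.centralizer ℂ S : Set (H →L[ℂ] H))
  centralizer_centralizer' := by
    change Set.centralizer (Set.centralizer (Set.centralizer _)) = Set.centralizer _
    simp

namespace CrossedProduct

section TensorTranslation

variable {G : Type*} [Group G] {E : Type*} [NormedAddCommGroup E] [InnerProductSpace ℂ E]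

theorem summable_translate {E : Type*} [NormedAddCommGroup E] (h : G)
    (ξ : lp (fun _ : G => E) 2) :
    Summable fun g : G => ‖ξ (h⁻¹ * g)‖ ^ (2 : ℝ≥0∞).toReal :=
  (Equiv.mulLeft h⁻¹).summable_iff.2 ((lp.memℓp ξ).summable (by norm_num))

theorem norm_rpow_two_le (T : E →L[ℂ] E) (x : E) :
    ‖T x‖ ^ (2 : ℝ≥0∞).toReal ≤ ‖T‖ ^ (2 : ℝ≥0∞).toReal * ‖x‖ ^ (2 : ℝ≥0∞).toReal := by
  rw [← Real.mul_rpow (norm_nonneg _) (norm_nonneg _)]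
  exact Real.rpow_le_rpow (norm_nonneg _) (T.le_opNorm _) (by norm_num)

theorem memlp_tensorTranslation (T : E →L[ℂ] E) (h : G) (ξ : lp (fun _ : G => E) 2) :
    Memℓp (fun g : G => T (ξ (h⁻¹ * g))) 2 :=
  memℓp_gen (Summable.of_nonneg_of_le (fun _ => by positivity)
    (fun g => norm_rpow_two_le T _) ((summable_translate h ξ).mul_left _))

/-- The linear map underlying `tensorTranslation`. -/
noncomputable def tensorTranslationₗ (T : E →L[ℂ] E) (h : G) :
    lp (fun _ : G => E) 2 →ₗ[ℂ] lp (fun _ : G => E) 2 where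
  toFun ξ := ⟨fun g => T (ξ (h⁻¹ * g)), memlp_tensorTranslation T h ξ⟩
  map_add' ξ η := by
    ext g
    exact map_add T (ξ (h⁻¹ * g)) (η (h⁻¹ * g))
  map_smul' c ξ := by
    ext g
    exact map_smul T c (ξ (h⁻¹ * g))

theorem norm_tensorTranslationₗ_le (T : E →L[ℂ] E) (h : G) (ξ : lp (fun _ : G => E) 2) :
    ‖tensorTranslationₗ T h ξ‖ ≤ ‖T‖ * ‖ξ‖ := by
  refine lp.norm_le_of_tsum_le (by norm_num) (by positivity) ?_
  have h1 : ∑' g : G, ‖ξ (h⁻¹ * g)‖ ^ (2 : ℝ≥0∞).toReal = ‖ξ‖ ^ (2 : ℝ≥0∞).toReal := by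
    rw [lp.norm_rpow_eq_tsum (by norm_num) ξ]
    exact (Equiv.mulLeft h⁻¹).tsum_eq (fun g => ‖ξ g‖ ^ (2 : ℝ≥0∞).toReal)
  rw [Real.mul_rpow (norm_nonneg _) (norm_nonneg _), ← h1, ← tsum_mul_left]
  exact ((memlp_tensorTranslation T h ξ).summable (by norm_num)).tsum_le_tsum
    (fun g => norm_rpow_two_le T (ξ (h⁻¹ * g))) ((summable_translate h ξ).mul_left _)

/-- For a Hilbert space `E` and a group `G`, the space `lp (fun _ : G => E) 2` of square summable
families is the Hilbert space `E ⊗ ℓ²(G)`. For a bounded operator `T` on `E` and `h` in `G`, this is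
the operator `T ⊗ λ_h`, where `λ` is the left regular representation:
`((T ⊗ λ_h) ξ) g = T (ξ (h⁻¹ g))`. -/
noncomputable def tensorTranslation (T : E →L[ℂ] E) (h : G) :
    lp (fun _ : G => E) 2 →L[ℂ] lp (fun _ : G => E) 2 :=
  (tensorTranslationₗ T h).mkContinuous ‖T‖ (norm_tensorTranslationₗ_le T h)

@[simp]
theorem tensorTranslation_apply (T : E →L[ℂ] E) (h g : G) (ξ : lp (fun _ : G => E) 2) :
    tensorTranslation T h ξ g = T (ξ (h⁻¹ * g)) := rfl

end TensorTranslation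

variable {G : Type*} [Group G] {X : Type*} [MeasurableSpace X] [MulAction G X]

/-- Multiplication by `f ∈ L^∞(X, μ)` as an operator on `L²(X, μ)`. -/
noncomputable def mulOp {μ : Measure X} (f : Lp ℂ ∞ μ) : Lp ℂ 2 μ →L[ℂ] Lp ℂ 2 μ :=
  (ContinuousLinearMap.mul ℂ ℂ).holderL μ ∞ 2 2 f

/-- The Koopman representation on `L²(X, μ)`: `(σ_h ξ) x = ξ (h⁻¹ x)`. -/
noncomputable def koopman (μ : Measure X) [MeasurableConstSMul G X] [SMulInvariantMeasure G X μ]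
    (h : G) : Lp ℂ 2 μ →L[ℂ] Lp ℂ 2 μ :=
  (Lp.compMeasurePreservingₗᵢ ℂ (fun x : X => h⁻¹ • x)
    (measurePreserving_smul h⁻¹ μ)).toContinuousLinearMap

/-- The Hilbert space `L²(X, μ) ⊗ ℓ²(G)` on which the crossed product `L^∞(X, μ) ⋊ G` acts. -/
abbrev HilbertSpace (G : Type*) {X : Type*} [MeasurableSpace X] (μ : Measure X) : Type _ :=
  lp (fun _ : G => Lp ℂ 2 μ) 2

/-- The copy `f ⊗ 1` of `f ∈ L^∞(X, μ)` in the crossed product. -/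
noncomputable def coeff (G : Type*) [Group G] {X : Type*} [MeasurableSpace X] {μ : Measure X}
    (f : Lp ℂ ∞ μ) : HilbertSpace G μ →L[ℂ] HilbertSpace G μ :=
  tensorTranslation (mulOp f) (1 : G)

/-- The canonical unitary `u_h = σ_h ⊗ λ_h` of the crossed product; it satisfies
`u_h f u_h* = f(h⁻¹ ·)`. -/
noncomputable def canonicalUnitary (μ : Measure X) [MeasurableConstSMul G X]
    [SMulInvariantMeasure G X μ] (h : G) : HilbertSpace G μ →L[ℂ] HilbertSpace G μ :=
  tensorTranslation (koopman μ h) h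

/-- For a probability measure preserving action of `G` on `(X, μ)` and a subgroup `L` of `G`, the
von Neumann subalgebra `L^∞(X, μ) ⋊ L` of `L^∞(X, μ) ⋊ G`: the von Neumann algebra generated by
`L^∞(X, μ)` and the canonical unitaries `u_h` with `h` in `L`. For `L = ⊤` it is the crossed product
`L^∞(X, μ) ⋊ G` itself. -/
noncomputable def crossedProduct (μ : Measure X) [MeasurableConstSMul G X]
    [SMulInvariantMeasure G X μ] (L : Subgroup G) : VonNeumannAlgebra (HilbertSpace G μ) :=
  generatedVonNeumannAlgebra
    (Set.range (coeff G (μ := μ)) ∪ {T | ∃ h ∈ L, T = canonicalUnitary μ h})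

end CrossedProduct

/-! Write `Ω = 1 ⊗ δ₁`, `σ` for the translation action on functions and `Λ` for the
quasi-centralizer of `⟨a⟩`.

1 → 2: the indicator of an `⟨a ^ z⟩`-invariant set lies in the relative commutant of `L^∞(X) ⋊ ⟨a ^
z⟩`, which gives ergodicity. Each `g ∈ Λ` commutes with `a ^ z` for some `z` in the index set
(`exists_mem_indexSet_commute`). Then `1_{Fix g} u_g` lies in that relative commutant; being scalar
with `g ≠ 1`, it vanishes, so `Fix g` is null.

2 → 3: if `Fix g` has positive measure, Poincaré recurrence for `a⁻¹` makes it meet some `a ^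
j`-translate of itself in positive measure, and `g⁻¹ aʲ g a⁻ʲ` fixes that intersection pointwise.
This commutator is in `Λ`, because `g` conjugates a nontrivial power of `a` to a power of `a`; if it
is trivial, `g` itself is in `Λ`. Ergodicity plays no role here.

3 → 1: for `T` in the relative commutant, commuting with `L^∞(X)` and freeness force `T Ω` to be
supported at the identity, and ergodicity makes its component there constant. Since `Ω` is
separating for the crossed product, `T` is scalar. -/

theorem mem_quasiCentralizer_zpowers {G : Type*} [Group G] {a g : G} :
    g ∈ quasiCentralizer (Subgroup.zpowers a) ↔ ∃ N : ℤ, N ≠ 0 ∧ Commute g (a ^ N) := by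
  constructor
  · rintro ⟨L, hL, hi, hg⟩
    obtain ⟨N, hN, -, h⟩ := Subgroup.exists_pow_mem_of_relIndex_ne_zero hi
      (Subgroup.mem_zpowers a)
    refine ⟨N, by exact_mod_cast hN.ne', ?_⟩
    rw [zpow_natCast]
    exact (Subgroup.mem_centralizer_iff.1 hg _ h.1).symm
  · rintro ⟨N, hN, h⟩
    refine ⟨Subgroup.zpowers (a ^ N), ?_, ?_, ?_⟩
    · rw [Subgroup.zpowers_le]
      exact zpow_mem (Subgroup.mem_zpowers a) N
    · have h1 : Subgroup.zpowers (a ^ N) =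
          (Subgroup.zpowers (Multiplicative.ofAdd N)).map (zpowersHom G a) := by
        simp [MonoidHom.map_zpowers]
      have h2 : Subgroup.zpowers a = (⊤ : Subgroup (Multiplicative ℤ)).map (zpowersHom G a) := by
        rw [← MonoidHom.range_eq_map]
        ext x
        simp [Subgroup.mem_zpowers_iff]
      have h3 : (Subgroup.zpowers (Multiplicative.ofAdd N)).index ≠ 0 := by
        have : (AddSubgroup.zmultiples N).index ≠ 0 := by
          rwa [Int.index_zmultiples, Int.natAbs_ne_zero]
        exact this
      rw [h1, h2, Subgroup.relIndex_map_map, top_sup_eq, Subgroup.relIndex_top_right]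
      exact ne_zero_of_dvd_ne_zero h3 (Subgroup.index_dvd_of_le le_sup_left)
    · rw [Subgroup.mem_centralizer_iff]
      rintro _ ⟨j, rfl⟩
      exact (h.zpow_right j).symm

/-- Conjugating `Commute w y` back by `g` shows that `g⁻¹ w g` commutes with `x`, as `w⁻¹` does too.
-/
theorem commute_commutator_of_conj {G : Type*} [Group G] {g x y w : G} (hx : Commute w x)
    (hy : Commute w y) (h : g * x * g⁻¹ = y) : Commute (g⁻¹ * w * g * w⁻¹) x := by
  have h1 : Commute (g⁻¹ * w * g) x := by
    have : x = g⁻¹ * y * g := by rw [← h]; group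
    rw [this]
    change _ * _ = _ * _
    calc g⁻¹ * w * g * (g⁻¹ * y * g) = g⁻¹ * (w * y) * g := by group
      _ = _ := by rw [hy.eq]; group
  exact h1.mul_left hx.inv_left

/-! ### Conjugation of powers of `a` in Baumslag-Solitar groups. -/

namespace BaumslagSolitar

variable (n m : ℤ)

/-- The generator `b` of `BS(n, m)`. -/
def b : BaumslagSolitar n m := PresentedGroup.of 1

theorem b_conj : b n m * a n m ^ n * (b n m)⁻¹ = a n m ^ m := by
  have := PresentedGroup.one_of_mem (rels := ({FreeGroup.of 1 * FreeGroup.of 0 ^ n *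
    (FreeGroup.of 1)⁻¹ * (FreeGroup.of 0 ^ m)⁻¹} : Set (FreeGroup (Fin 2)))) rfl
  simp only [map_mul, map_inv, map_zpow] at this
  exact mul_inv_eq_one.1 this

theorem b_conj_mul (j : ℤ) : b n m * a n m ^ (n * j) * (b n m)⁻¹ = a n m ^ (m * j) := by
  rw [zpow_mul, zpow_mul, ← b_conj, conj_zpow]

theorem induction {n m : ℤ} {P : BaumslagSolitar n m → Prop} (ha : P (a n m)) (hb : P (b n m))
    (one : P 1) (mul : ∀ x y, P x → P y → P (x * y)) (inv : ∀ x, P x → P x⁻¹)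
    (g : BaumslagSolitar n m) : P g := by
  have : g ∈ Subgroup.closure (Set.range (PresentedGroup.of)) := by
    rw [PresentedGroup.closure_range_of]; trivial
  induction this using Subgroup.closure_induction with
  | mem x hx =>
    obtain ⟨i, rfl⟩ := hx
    fin_cases i
    · exact ha
    · exact hb
  | one => exact one
  | mul x y _ _ hx hy => exact mul x y hx hy
  | inv x _ hx => exact inv x hx

variable {n m}

/-- In the affine action of `BS(n, m)` on `ℚ`, `a` acts by a nontrivial translation. -/
theorem zpow_a_injective (hn : n ≠ 0) (hm : m ≠ 0) :
    Function.Injective fun j : ℤ => a n m ^ j := by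
  have hn' : (n : ℚ) ≠ 0 := by exact_mod_cast hn
  have hm' : (m : ℚ) ≠ 0 := by exact_mod_cast hm
  -- Scaling by `m / n` conjugates translation by `n` into translation by `m`.
  let f : Fin 2 → Equiv.Perm ℚ := ![Equiv.addRight 1, Equiv.mulLeft₀ (m / n : ℚ) (by positivity)]
  have hf : ∀ r ∈ ({FreeGroup.of 1 * FreeGroup.of 0 ^ n *
      (FreeGroup.of 1)⁻¹ * (FreeGroup.of 0 ^ m)⁻¹} : Set (FreeGroup (Fin 2))),
      FreeGroup.lift f r = 1 := by
    rintro _ rfl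
    simp only [map_mul, map_inv, map_zpow, FreeGroup.lift_apply_of]
    rw [mul_inv_eq_one, mul_inv_eq_iff_eq_mul]
    ext x
    simp [f]
    field_simp
  intro i j hij
  have := congrArg (PresentedGroup.toGroup hf) hij
  simp only [map_zpow, a, PresentedGroup.toGroup.of] at this
  have := congrArg (fun e : Equiv.Perm ℚ => e 0) this
  simpa [f] using this

/-- Every element conjugates some nontrivial power of `a` into a nontrivial power of `a`. -/
theorem exists_conj_zpow (hn : n ≠ 0) (hm : m ≠ 0) (g : BaumslagSolitar n m) :
    ∃ k l : ℤ, k ≠ 0 ∧ l ≠ 0 ∧ g * a n m ^ k * g⁻¹ = a n m ^ l := by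
  induction g using induction with
  | ha => exact ⟨1, 1, by simp, by simp, by simp⟩
  | hb => exact ⟨n, m, hn, hm, b_conj n m⟩
  | one => exact ⟨1, 1, by simp, by simp, by simp⟩
  | mul x y hx hy =>
    obtain ⟨k, l, hk, hl, h⟩ := hx
    obtain ⟨k', l', hk', hl', h'⟩ := hy
    refine ⟨k' * k, l * l', mul_ne_zero hk' hk, mul_ne_zero hl hl', ?_⟩
    calc x * y * a n m ^ (k' * k) * (x * y)⁻¹
        = x * (y * a n m ^ k' * y⁻¹) ^ k * x⁻¹ := by rw [conj_zpow, zpow_mul]; group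
      _ = (x * a n m ^ k * x⁻¹) ^ l' := by
          rw [h', ← zpow_mul, mul_comm, zpow_mul, conj_zpow]
      _ = _ := by rw [h, zpow_mul]
  | inv x hx =>
    obtain ⟨k, l, hk, hl, h⟩ := hx
    exact ⟨l, k, hl, hk, by rw [← h]; group⟩

theorem commutator_mem_quasiCentralizer (hn : n ≠ 0) (hm : m ≠ 0) (g : BaumslagSolitar n m)
    (j : ℤ) : g⁻¹ * a n m ^ j * g * (a n m ^ j)⁻¹ ∈
      quasiCentralizer (Subgroup.zpowers (a n m)) := by
  obtain ⟨k, l, hk, -, h⟩ := exists_conj_zpow hn hm g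
  exact mem_quasiCentralizer_zpowers.2 ⟨k, hk, commute_commutator_of_conj
    (Commute.zpow_zpow_self _ _ _) (Commute.zpow_zpow_self _ _ _) h⟩

/-- Elements conjugate `a ^ (k n₀ ^ s m₀ ^ t)` into a power of the same form, provided that `s` and
`t` are large. -/
theorem exists_conj_gcd_mul_pow {k n₀ m₀ : ℤ} (hn : n = k * n₀) (hm : m = k * m₀)
    (g : BaumslagSolitar n m) :
    ∃ (e : ℤ) (r : ℕ), ∀ s t : ℕ, r ≤ s → r ≤ t → ∃ s' t' : ℕ, (s' : ℤ) = s - e ∧ (t' : ℤ) = t + e ∧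
      g * a n m ^ (k * n₀ ^ s * m₀ ^ t) * g⁻¹ = a n m ^ (k * n₀ ^ s' * m₀ ^ t') := by
  induction g using induction with
  | ha => exact ⟨0, 0, fun s t _ _ => ⟨s, t, by simp, by simp, by group⟩⟩
  | hb =>
    -- One factor `n₀` is needed to form a multiple of `n = k n₀`; conjugation by `b` replaces it by
    -- `m₀`. Thus `e` records the exponent sum of `b`.
    refine ⟨1, 1, fun s t hs ht => ?_⟩
    obtain ⟨s, rfl⟩ := Nat.exists_eq_add_of_le' hs
    refine ⟨s, t + 1, by push_cast; ring, by push_cast; ring, ?_⟩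
    have := b_conj_mul n m (n₀ ^ s * m₀ ^ t)
    convert this using 2
    · congr 2
      rw [hn]; ring
    · rw [hm]; ring
  | one => exact ⟨0, 0, fun s t _ _ => ⟨s, t, by simp, by simp, by group⟩⟩
  | mul x y hx hy =>
    obtain ⟨e, r, h⟩ := hx
    obtain ⟨e', r', h'⟩ := hy
    -- Conjugation by `y` shifts the exponents by `e'` in opposite directions; the extra `|e'|`
    -- keeps both at least `r`.
    refine ⟨e + e', r + r' + e'.natAbs, fun s t hs ht => ?_⟩
    obtain ⟨s', t', hs', ht', h1⟩ := h' s t (by omega) (by omega)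
    obtain ⟨s'', t'', hs'', ht'', h2⟩ := h s' t' (by omega) (by omega)
    refine ⟨s'', t'', by omega, by omega, ?_⟩
    rw [← h2, ← h1]
    group
  | inv x hx =>
    obtain ⟨e, r, h⟩ := hx
    refine ⟨-e, r + e.natAbs, fun s t hs ht => ?_⟩
    obtain ⟨s', hs'⟩ := Int.eq_ofNat_of_zero_le (a := s + e) (by omega)
    obtain ⟨t', ht'⟩ := Int.eq_ofNat_of_zero_le (a := t - e) (by omega)
    obtain ⟨s'', t'', hs'', ht'', h2⟩ := h s' t' (by omega) (by omega)
    obtain rfl : s'' = s := by omega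
    obtain rfl : t'' = t := by omega
    exact ⟨s', t', by omega, by omega, by rw [← h2]; group⟩

/-- Conjugation by `g` sends a suitable `a ^ Z` to some `a ^ W`. As `g` centralizes some `a ^ N`
with `N ≠ 0`, taking `N`-th powers gives `W N = Z N`, hence `W = Z`. -/
theorem exists_mem_indexSet_commute (hn : n ≠ 0) (hm : m ≠ 0) {g : BaumslagSolitar n m}
    (hg : g ∈ quasiCentralizer (Subgroup.zpowers (a n m))) :
    ∃ z ∈ indexSet n m, Commute g (a n m ^ z) := by
  obtain ⟨N, hN, hc⟩ := mem_quasiCentralizer_zpowers.1 hg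
  obtain ⟨e, r, h⟩ := exists_conj_gcd_mul_pow (k := Int.gcd n m)
    (Int.mul_ediv_cancel' (Int.gcd_dvd_left ..)).symm
    (Int.mul_ediv_cancel' (Int.gcd_dvd_right ..)).symm g
  -- The `+ 1` secures `s + t > 0`, as membership in `indexSet` requires.
  obtain ⟨s', t', -, -, h1⟩ := h (r + 1) (r + 1) (by omega) (by omega)
  set Z : ℤ := Int.gcd n m * (n / Int.gcd n m) ^ (r + 1) * (m / Int.gcd n m) ^ (r + 1) with hZ
  set W : ℤ := Int.gcd n m * (n / Int.gcd n m) ^ s' * (m / Int.gcd n m) ^ t'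
  have hWZ : W * N = Z * N := by
    apply zpow_a_injective hn hm
    change a n m ^ (W * N) = a n m ^ (Z * N)
    rw [zpow_mul, ← h1, conj_zpow, ← zpow_mul, mul_comm, zpow_mul]
    exact mul_inv_eq_iff_eq_mul.2 (hc.zpow_right Z).eq
  rw [mul_right_cancel₀ hN hWZ] at h1
  have hcZ : Commute g (a n m ^ Z) := mul_inv_eq_iff_eq_mul.1 h1
  refine ⟨Z.natAbs, ⟨r + 1, r + 1, by omega, ?_⟩, ?_⟩
  · simp [hZ, Int.natAbs_mul, Int.natAbs_pow]
  · rw [← zpow_natCast]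
    rcases Int.natAbs_eq Z with h | h
    · rwa [← h]
    · rw [h, zpow_neg, Commute.inv_right_iff] at hcZ
      exact hcZ

end BaumslagSolitar

/-! ### Essential freeness and ergodicity: from subgroups and single elements. -/

section EssentiallyFree

variable {G : Type*} [Group G] {X : Type*} [MulAction G X] [MeasurableSpace X]

theorem measurableSet_fixedBy [StandardBorelSpace X] [MeasurableConstSMul G X] (g : G) :
    MeasurableSet (MulAction.fixedBy X g) := by
  let := upgradeStandardBorel X
  exact measurableSet_eq_fun (measurable_const_smul g) measurable_id

/-- If the quasi-centralizer of `⟨a⟩` contains the commutators `[g⁻¹, aʲ]` and acts essentially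
freely, then so does the whole group. -/
theorem EssentiallyFree.of_quasiCentralizer_zpowers [StandardBorelSpace X]
    [MeasurableConstSMul G X] {μ : Measure X} [IsFiniteMeasure μ] [SMulInvariantMeasure G X μ]
    {a : G} (hcomm : ∀ (g : G) (j : ℤ), g⁻¹ * a ^ j * g * (a ^ j)⁻¹ ∈
      quasiCentralizer (Subgroup.zpowers a))
    (hfree : EssentiallyFree (quasiCentralizer (Subgroup.zpowers a)) μ) : EssentiallyFree G μ := by
  have hfree' (g : G) (hg : g ∈ quasiCentralizer (Subgroup.zpowers a)) (h1 : g ≠ 1) :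
      μ (MulAction.fixedBy X g) = 0 := hfree ⟨g, hg⟩ (by simpa using h1)
  intro g hg
  by_contra hμ
  -- Poincaré recurrence, with `j > 0`.
  obtain ⟨j, hj, hinter⟩ := (measurePreserving_smul a⁻¹ μ).conservative.exists_gt_measure_inter_ne_zero
    (measurableSet_fixedBy (X := X) g).nullMeasurableSet hμ 0
  -- A trivial commutator means that `g` commutes with `a ^ j`, so `g` is already in the
  -- quasi-centralizer. Otherwise the commutator fixes every `x` for which both `x` and `a⁻ʲ x` are
  -- fixed by `g`.
  by_cases h1 : g⁻¹ * a ^ (j : ℤ) * g * (a ^ (j : ℤ))⁻¹ = 1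
  · refine hμ (hfree' g (mem_quasiCentralizer_zpowers.2 ⟨j, by exact_mod_cast hj.ne', ?_⟩) hg)
    rw [mul_inv_eq_one, mul_assoc, inv_mul_eq_iff_eq_mul] at h1
    exact h1.symm
  · refine hinter (measure_mono_null ?_ (hfree' _ (hcomm g j) h1))
    rintro x ⟨hx, hx'⟩
    simp only [smul_iterate, Set.mem_preimage, MulAction.mem_fixedBy] at hx hx' ⊢
    rw [mul_smul, mul_smul, mul_smul, zpow_natCast, ← inv_pow, hx', inv_pow, smul_inv_smul,
      inv_smul_eq_iff, hx]

end EssentiallyFree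

open scoped Pointwise in
theorem ErgodicSMul.ergodic_smul {G X : Type*} [Group G] [MulAction G X] [MeasurableSpace X]
    [MeasurableConstSMul G X] {μ : Measure X} (g : G) [h : ErgodicSMul (Subgroup.zpowers g) X μ] :
    Ergodic (g • · : X → X) μ := by
  have hmp : MeasurePreserving (g • · : X → X) μ μ :=
    measurePreserving_smul (⟨g, Subgroup.mem_zpowers g⟩ : Subgroup.zpowers g) μ
  refine ⟨hmp, ⟨fun s hs hgs => ?_⟩⟩
  refine aeconst_of_forall_smul_ae_eq (Subgroup.zpowers g) hs.nullMeasurableSet fun k => ?_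
  have hg : g ∈ MulAction.stabilizer G s := by
    rw [← inv_mem_iff, MulAction.mem_stabilizer_iff, ← Set.preimage_smul]
    exact hgs
  have : (k : G) • s = s := (Subgroup.zpowers_le.2 hg) k.2
  exact Filter.EventuallyEq.of_eq this

/-! ### Left and right translation operators on `E ⊗ ℓ²(G)`. -/

namespace CrossedProduct

section Tensor

variable {G : Type*} [Group G] {E : Type*} [NormedAddCommGroup E] [InnerProductSpace ℂ E]

theorem tensorTranslation_mul (S T : E →L[ℂ] E) (h k : G) :
    tensorTranslation S h * tensorTranslation T k = tensorTranslation (S * T) (h * k) := by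
  ext ξ g
  simp [mul_assoc]

theorem star_tensorTranslation [CompleteSpace E] (T : E →L[ℂ] E) (h : G) :
    star (tensorTranslation T h) = tensorTranslation (star T) h⁻¹ := by
  rw [ContinuousLinearMap.star_eq_adjoint, eq_comm, ContinuousLinearMap.eq_adjoint_iff]
  intro ξ η
  rw [lp.inner_eq_tsum, lp.inner_eq_tsum, ← (Equiv.mulLeft h⁻¹).tsum_eq]
  refine tsum_congr fun g => ?_
  simp [ContinuousLinearMap.star_eq_adjoint, ContinuousLinearMap.adjoint_inner_left]

theorem tensorTranslation_single [DecidableEq G] (T : E →L[ℂ] E) (h k : G) (x : E) :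
    tensorTranslation T h (lp.single 2 k x) = lp.single 2 (h * k) (T x) := by
  ext1
  funext g
  by_cases hg : g = h * k
  · subst hg
    simp
  · have : h⁻¹ * g ≠ k := fun h' => hg (by rw [← h', mul_inv_cancel_left])
    simp [hg, this]

variable {T : G → E →L[ℂ] E} {C : ℝ}

theorem memlp_rightTranslation (hT : ∀ g, ‖T g‖ ≤ C) (h : G) (ξ : lp (fun _ : G => E) 2) :
    Memℓp (fun g => T g (ξ (g * h))) 2 := by
  have : Memℓp (fun g => C * ‖ξ (g * h)‖) 2 := by
    refine Memℓp.const_mul (memℓp_gen ?_) _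
    simp only [norm_norm]
    exact (Equiv.mulRight h).summable_iff.2 ((lp.memℓp ξ).summable (by norm_num))
  exact this.mono fun g => (T g).le_of_opNorm_le (hT g) _

theorem tsum_norm_rightTranslation_le (hT : ∀ g, ‖T g‖ ≤ C) (h : G)
    (ξ : lp (fun _ : G => E) 2) :
    ∑' g, ‖T g (ξ (g * h))‖ ^ (2 : ℝ≥0∞).toReal ≤ (C * ‖ξ‖) ^ (2 : ℝ≥0∞).toReal := by
  have hC : 0 ≤ C := (norm_nonneg _).trans (hT 1)
  have h1 : ∑' g : G, ‖ξ (g * h)‖ ^ (2 : ℝ≥0∞).toReal = ‖ξ‖ ^ (2 : ℝ≥0∞).toReal := by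
    rw [lp.norm_rpow_eq_tsum (by norm_num) ξ]
    exact (Equiv.mulRight h).tsum_eq (fun g => ‖ξ g‖ ^ (2 : ℝ≥0∞).toReal)
  have h2 : Summable fun g : G => ‖ξ (g * h)‖ ^ (2 : ℝ≥0∞).toReal :=
    (Equiv.mulRight h).summable_iff.2 ((lp.memℓp ξ).summable (by norm_num))
  rw [Real.mul_rpow hC (norm_nonneg _), ← h1, ← tsum_mul_left]
  refine ((memlp_rightTranslation hT h ξ).summable (by norm_num)).tsum_le_tsum (fun g => ?_)
    (h2.mul_left _)
  rw [← Real.mul_rpow hC (norm_nonneg _)]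
  exact Real.rpow_le_rpow (norm_nonneg _) ((T g).le_of_opNorm_le (hT g) _) (by norm_num)

/-- For a uniformly bounded family `T` of operators, the operator `ξ ↦ (g ↦ T g (ξ (g h)))`. -/
noncomputable def rightTranslation (T : G → E →L[ℂ] E) {C : ℝ} (hT : ∀ g, ‖T g‖ ≤ C) (h : G) :
    lp (fun _ : G => E) 2 →L[ℂ] lp (fun _ : G => E) 2 :=
  LinearMap.mkContinuous
    { toFun := fun ξ => ⟨fun g => T g (ξ (g * h)), memlp_rightTranslation hT h ξ⟩
      map_add' := fun ξ η => by
        ext g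
        exact map_add (T g) (ξ (g * h)) (η (g * h))
      map_smul' := fun c ξ => by
        ext g
        exact map_smul (T g) c (ξ (g * h)) }
    C fun ξ => lp.norm_le_of_tsum_le (by norm_num)
      (mul_nonneg ((norm_nonneg _).trans (hT 1)) (norm_nonneg _))
      (tsum_norm_rightTranslation_le hT h ξ)

@[simp]
theorem rightTranslation_apply (hT : ∀ g, ‖T g‖ ≤ C) (h g : G) (ξ : lp (fun _ : G => E) 2) :
    rightTranslation T hT h ξ g = T g (ξ (g * h)) := rfl

theorem rightTranslation_single [DecidableEq G] (hT : ∀ g, ‖T g‖ ≤ C) (h : G) (x : E) :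
    rightTranslation T hT h (lp.single 2 1 x) = lp.single 2 h⁻¹ (T h⁻¹ x) := by
  ext1
  funext g
  by_cases hg : g = h⁻¹
  · subst hg
    simp
  · have : g * h ≠ 1 := fun h' => hg (eq_inv_of_mul_eq_one_left h')
    simp [hg, this]

/-- Left and right translations of `G` commute, so only the compatibility `hST` of the coefficients
is at stake. -/
theorem commute_tensorTranslation_rightTranslation (hT : ∀ g, ‖T g‖ ≤ C) {S : E →L[ℂ] E} {k : G}
    (hST : ∀ g, S * T (k⁻¹ * g) = T g * S) (h : G) :
    Commute (tensorTranslation S k) (rightTranslation T hT h) := by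
  ext ξ g
  simpa [mul_assoc] using DFunLike.congr_fun (hST g) (ξ (k⁻¹ * (g * h)))

end Tensor

/-! ### Multiplication operators and the Koopman representation. -/

section L2

variable {X : Type*} [MeasurableSpace X] {μ : Measure X}

theorem coeFn_mulOp (f : Lp ℂ ∞ μ) (ξ : Lp ℂ 2 μ) : mulOp f ξ =ᵐ[μ] fun x => f x * ξ x :=
  (ContinuousLinearMap.mul ℂ ℂ).coeFn_holder f ξ

theorem mulOp_mul_comm (f f' : Lp ℂ ∞ μ) : mulOp f * mulOp f' = mulOp f' * mulOp f := by
  ext1 ξ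
  apply Lp.ext
  filter_upwards [coeFn_mulOp f (mulOp f' ξ), coeFn_mulOp f' ξ, coeFn_mulOp f' (mulOp f ξ),
    coeFn_mulOp f ξ] with x h1 h2 h3 h4
  simp only [ContinuousLinearMap.mul_def, ContinuousLinearMap.comp_apply, h1, h2, h3, h4, mul_left_comm]

theorem star_mulOp (f : Lp ℂ ∞ μ) : star (mulOp f) = mulOp (star f) := by
  rw [ContinuousLinearMap.star_eq_adjoint, eq_comm, ContinuousLinearMap.eq_adjoint_iff]
  intro ξ η
  rw [L2.inner_def, L2.inner_def]
  refine integral_congr_ae ?_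
  filter_upwards [coeFn_mulOp (star f) ξ, coeFn_mulOp f η, Lp.coeFn_star f] with x h1 h2 h3
  simp only [h1, h2, h3, Pi.star_apply, RCLike.inner_apply, map_mul, RCLike.star_def,
    RingHomCompTriple.comp_apply, RingHom.id_apply]
  ring

/-- Supplies the uniform bound over all translates of one function that `rightTranslation` needs. -/
theorem exists_norm_mulOp_le (c : ℝ) : ∃ C, ∀ f : Lp ℂ ∞ μ, ‖f‖ ≤ c → ‖mulOp f‖ ≤ C :=
  ⟨_, fun _ hf => ((ContinuousLinearMap.mul ℂ ℂ).holderL μ ∞ 2 2).le_of_opNorm_le_of_le le_rfl hf⟩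

variable {G : Type*} [Group G] [MulAction G X] [MeasurableConstSMul G X]
  [SMulInvariantMeasure G X μ]

/-- The action of `G` on `L^∞(X, μ)`: `(σ_h f) x = f (h⁻¹ x)`. -/
noncomputable def translate (h : G) (f : Lp ℂ ∞ μ) : Lp ℂ ∞ μ :=
  Lp.compMeasurePreserving (fun x : X => h⁻¹ • x) (measurePreserving_smul h⁻¹ μ) f

theorem coeFn_translate (h : G) (f : Lp ℂ ∞ μ) : translate h f =ᵐ[μ] fun x => f (h⁻¹ • x) :=
  Lp.coeFn_compMeasurePreserving f (measurePreserving_smul h⁻¹ μ)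

theorem norm_translate (h : G) (f : Lp ℂ ∞ μ) : ‖translate h f‖ = ‖f‖ :=
  Lp.norm_compMeasurePreserving f (measurePreserving_smul h⁻¹ μ)

theorem coeFn_koopman (h : G) (ξ : Lp ℂ 2 μ) : koopman μ h ξ =ᵐ[μ] fun x => ξ (h⁻¹ • x) :=
  Lp.coeFn_compMeasurePreserving ξ (measurePreserving_smul h⁻¹ μ)

theorem ae_smul {p : X → Prop} (h : G) (hp : ∀ᵐ x ∂μ, p x) : ∀ᵐ x ∂μ, p (h • x) :=
  (measurePreserving_smul h μ).quasiMeasurePreserving.ae hp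

theorem translate_mul (h k : G) (f : Lp ℂ ∞ μ) :
    translate (h * k) f = translate h (translate k f) := by
  apply Lp.ext
  filter_upwards [coeFn_translate (h * k) f, coeFn_translate h (translate k f),
    ae_smul h⁻¹ (coeFn_translate k f)] with x h1 h2 h3
  rw [h1, h2, h3, mul_inv_rev, mul_smul]

theorem translate_one (f : Lp ℂ ∞ μ) : translate (1 : G) f = f := by
  apply Lp.ext
  filter_upwards [coeFn_translate (1 : G) f] with x h1
  rw [h1, inv_one, one_smul]

theorem koopman_mul (h k : G) : koopman μ h * koopman μ k = koopman μ (h * k) := by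
  ext1 ξ
  apply Lp.ext
  filter_upwards [coeFn_koopman (h * k) ξ, coeFn_koopman h (koopman μ k ξ),
    ae_smul h⁻¹ (coeFn_koopman k ξ)] with x h1 h2 h3
  rw [ContinuousLinearMap.mul_def, ContinuousLinearMap.comp_apply, h1, h2, h3, mul_inv_rev, mul_smul]

theorem koopman_mul_mulOp (h : G) (f : Lp ℂ ∞ μ) :
    koopman μ h * mulOp f = mulOp (translate h f) * koopman μ h := by
  ext1 ξ
  apply Lp.ext
  filter_upwards [coeFn_koopman h (mulOp f ξ), ae_smul h⁻¹ (coeFn_mulOp f ξ),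
    coeFn_mulOp (translate h f) (koopman μ h ξ), coeFn_translate h f, coeFn_koopman h ξ]
    with x h1 h2 h3 h4 h5
  simp only [ContinuousLinearMap.mul_def, ContinuousLinearMap.comp_apply, h1, h2, h3, h4, h5]

theorem star_koopman (h : G) : star (koopman μ h) = koopman μ h⁻¹ := by
  rw [ContinuousLinearMap.star_eq_adjoint, eq_comm, ContinuousLinearMap.eq_adjoint_iff]
  intro ξ η
  rw [← LinearIsometry.inner_map_map (Lp.compMeasurePreservingₗᵢ ℂ (fun x : X => h⁻¹ • x)
    (measurePreserving_smul h⁻¹ μ))]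
  change inner ℂ ((koopman μ h * koopman μ h⁻¹) ξ) (koopman μ h η) = _
  rw [koopman_mul, mul_inv_cancel]
  congr 1
  apply Lp.ext
  filter_upwards [coeFn_koopman (1 : G) ξ] with x h1
  rw [h1, inv_one, one_smul]

end L2

end CrossedProduct

/-! ### Commutants of generated von Neumann algebras. -/

section GeneratedVonNeumannAlgebra

variable {H : Type*} [NormedAddCommGroup H] [InnerProductSpace ℂ H] [CompleteSpace H]
  {S : Set (H →L[ℂ] H)}

theorem subset_generatedVonNeumannAlgebra {T : H →L[ℂ] H} (hT : T ∈ S) :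
    T ∈ generatedVonNeumannAlgebra S := by
  change T ∈ StarSubalgebra.centralizer ℂ (StarSubalgebra.centralizer ℂ S : Set (H →L[ℂ] H))
  rw [StarSubalgebra.mem_centralizer_iff]
  intro R hR
  exact ⟨((StarSubalgebra.mem_centralizer_iff ℂ).1 hR T hT).1.symm,
    ((StarSubalgebra.mem_centralizer_iff ℂ).1 (star_mem hR) T hT).1.symm⟩

theorem mem_commutant_generatedVonNeumannAlgebra {R : H →L[ℂ] H} :
    R ∈ (generatedVonNeumannAlgebra S).commutant ↔
      ∀ T ∈ S, Commute T R ∧ Commute (star T) R := by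
  rw [VonNeumannAlgebra.mem_commutant_iff]
  constructor
  · intro h T hT
    have := subset_generatedVonNeumannAlgebra hT
    exact ⟨h T this, h _ (star_mem this)⟩
  · intro h T hT
    exact (((StarSubalgebra.mem_centralizer_iff ℂ).1 hT R
      ((StarSubalgebra.mem_centralizer_iff ℂ).2 h)).1).symm

theorem smul_id_mem_vonNeumannAlgebra (c : ℂ) (M : VonNeumannAlgebra H) :
    c • ContinuousLinearMap.id ℂ H ∈ M :=
  M.toStarSubalgebra.smul_mem (one_mem M.toStarSubalgebra) c

end GeneratedVonNeumannAlgebra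

/-! ### The crossed product, its commutant and relative commutants. -/

namespace CrossedProduct

variable {G : Type*} [Group G] {X : Type*} [MeasurableSpace X] {μ : Measure X}

theorem star_coeff (f : Lp ℂ ∞ μ) : star (coeff G f) = coeff G (star f) := by
  rw [coeff, star_tensorTranslation, star_mulOp, inv_one, coeff]

theorem commute_coeff (f f' : Lp ℂ ∞ μ) : Commute (coeff G f) (coeff G f') := by
  change _ * _ = _ * _
  rw [coeff, coeff, tensorTranslation_mul, tensorTranslation_mul, mulOp_mul_comm]

variable [MulAction G X] [MeasurableConstSMul G X] [SMulInvariantMeasure G X μ]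

theorem coeff_mem_crossedProduct (f : Lp ℂ ∞ μ) (L : Subgroup G) :
    coeff G f ∈ crossedProduct μ L :=
  subset_generatedVonNeumannAlgebra (Or.inl ⟨f, rfl⟩)

theorem canonicalUnitary_mem_crossedProduct {L : Subgroup G} {h : G} (hh : h ∈ L) :
    canonicalUnitary μ h ∈ crossedProduct μ L :=
  subset_generatedVonNeumannAlgebra (Or.inr ⟨h, hh, rfl⟩)

theorem star_canonicalUnitary (h : G) :
    star (canonicalUnitary μ h) = canonicalUnitary μ h⁻¹ := by
  rw [canonicalUnitary, star_tensorTranslation, star_koopman, canonicalUnitary]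

theorem canonicalUnitary_mul (h k : G) :
    canonicalUnitary μ h * canonicalUnitary μ k = canonicalUnitary μ (h * k) := by
  rw [canonicalUnitary, canonicalUnitary, tensorTranslation_mul, koopman_mul, canonicalUnitary]

theorem canonicalUnitary_mul_coeff (h : G) (f : Lp ℂ ∞ μ) :
    canonicalUnitary μ h * coeff G f = coeff G (translate h f) * canonicalUnitary μ h := by
  rw [canonicalUnitary, coeff, coeff, tensorTranslation_mul, tensorTranslation_mul,
    koopman_mul_mulOp, mul_one, one_mul]

theorem mem_commutant_crossedProduct {L : Subgroup G} {R : HilbertSpace G μ →L[ℂ] HilbertSpace G μ} :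
    R ∈ (crossedProduct μ L).commutant ↔
      (∀ f, Commute (coeff G f) R) ∧ ∀ h ∈ L, Commute (canonicalUnitary μ h) R := by
  rw [crossedProduct, mem_commutant_generatedVonNeumannAlgebra]
  constructor
  · intro h
    exact ⟨fun f => (h _ (Or.inl ⟨f, rfl⟩)).1, fun k hk => (h _ (Or.inr ⟨k, hk, rfl⟩)).1⟩
  · rintro ⟨h1, h2⟩ _ (⟨f, rfl⟩ | ⟨k, hk, rfl⟩)
    · exact ⟨h1 f, by rw [star_coeff]; exact h1 _⟩
    · exact ⟨h2 k hk, by rw [star_canonicalUnitary]; exact h2 _ (inv_mem hk)⟩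

/-- The elements of the commutant of the crossed product that multiply the component at `g` by
`σ_g f` and translate by `h` on the right. -/
theorem exists_rightTranslation_mem_commutant (f : Lp ℂ ∞ μ) (h : G) :
    ∃ R ∈ (crossedProduct μ (⊤ : Subgroup G)).commutant,
      (∀ ξ g, R ξ g = mulOp (translate g f) (ξ (g * h))) ∧
      ∀ [DecidableEq G] x, R (lp.single 2 1 x) = lp.single 2 h⁻¹ (mulOp (translate h⁻¹ f) x) := by
  obtain ⟨C, hC⟩ := exists_norm_mulOp_le (μ := μ) ‖f‖
  have hT (g : G) : ‖mulOp (translate g f)‖ ≤ C := hC _ (norm_translate g f).le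
  refine ⟨rightTranslation _ hT h, mem_commutant_crossedProduct.2 ⟨fun f' => ?_, fun k _ => ?_⟩,
    fun ξ g => rightTranslation_apply hT h g ξ, fun x => rightTranslation_single hT h x⟩
  · refine commute_tensorTranslation_rightTranslation hT (fun g => ?_) h
    rw [inv_one, one_mul, mulOp_mul_comm]
  -- Twisting the component at `g` by `σ_g` is what makes this work: `σ_k σ_{k⁻¹g} f = σ_g f`.
  · refine commute_tensorTranslation_rightTranslation hT (fun g => ?_) h
    rw [koopman_mul_mulOp, ← translate_mul, mul_inv_cancel_left]

/-- One bounded injective function suffices: `arctan` of a measurable embedding into `ℝ`. Where `ξ`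
is nonzero, its values at `x` and `g⁻¹ x` agree, so `x` is fixed by `g`. -/
theorem eq_zero_of_mulOp_translate_eq [StandardBorelSpace X] [IsFiniteMeasure μ] {g : G}
    (hg : μ (MulAction.fixedBy X g) = 0) {ξ : Lp ℂ 2 μ}
    (h : ∀ f, mulOp f ξ = mulOp (translate g f) ξ) : ξ = 0 := by
  obtain ⟨e, he⟩ := exists_measurableEmbedding_real X
  have hφ : MemLp (fun x => (Real.arctan (e x) : ℂ)) ∞ μ := by
    refine memLp_top_of_bound ?_ (Real.pi / 2) (Filter.Eventually.of_forall fun x => ?_)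
    · exact (Complex.measurable_ofReal.comp
        (Real.continuous_arctan.measurable.comp he.measurable)).aestronglyMeasurable
    · rw [Complex.norm_real, Real.norm_eq_abs, abs_le]
      exact ⟨(Real.neg_pi_div_two_lt_arctan _).le, (Real.arctan_lt_pi_div_two _).le⟩
  have h0 := h (hφ.toLp _)
  rw [Lp.eq_zero_iff_ae_eq_zero]
  have hg' : ∀ᵐ x ∂μ, x ∉ MulAction.fixedBy X g := measure_eq_zero_iff_ae_notMem.1 hg
  filter_upwards [coeFn_mulOp (hφ.toLp _) ξ, coeFn_mulOp (translate g (hφ.toLp _)) ξ,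
    coeFn_translate g (hφ.toLp _), hφ.coeFn_toLp, ae_smul g⁻¹ hφ.coeFn_toLp, hg']
    with x h1 h2 h3 h4 h5 h6
  rw [h0, h2, h3, h4, h5] at h1
  by_contra hx
  have h7 := mul_right_cancel₀ hx h1
  rw [Complex.ofReal_inj] at h7
  have h8 := he.injective (Real.arctan_injective h7)
  rw [inv_smul_eq_iff] at h8
  exact h6 h8.symm

section IsFiniteMeasure

/-- The vector `1 ⊗ δ₁`. -/
noncomputable def vacuum (G : Type*) [Group G] [DecidableEq G] {X : Type*} [MeasurableSpace X]
    (μ : Measure X) [IsFiniteMeasure μ] : HilbertSpace G μ :=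
  lp.single 2 1 (Lp.const 2 μ 1)

theorem coeFn_mulOp_const [IsFiniteMeasure μ] (f : Lp ℂ ∞ μ) :
    mulOp f (Lp.const 2 μ 1) =ᵐ[μ] f := by
  filter_upwards [coeFn_mulOp f (Lp.const 2 μ 1), Lp.coeFn_const (p := 2) (μ := μ) (1 : ℂ)]
    with x h1 h2
  rw [h1, h2, Function.const_apply, mul_one]

theorem coeFn_translate_const [IsFiniteMeasure μ] (h : G) (c : ℂ) :
    translate h (Lp.const ∞ μ c) =ᵐ[μ] fun _ => c := by
  filter_upwards [coeFn_translate h (Lp.const ∞ μ c),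
    ae_smul h⁻¹ (Lp.coeFn_const (p := ∞) (μ := μ) c)] with x h1 h2
  rw [h1, h2, Function.const_apply]

theorem koopman_const [IsFiniteMeasure μ] (h : G) (c : ℂ) :
    koopman μ h (Lp.const 2 μ c) = Lp.const 2 μ c := by
  apply Lp.ext
  filter_upwards [coeFn_koopman h (Lp.const 2 μ c), Lp.coeFn_const (p := 2) (μ := μ) c,
    ae_smul h⁻¹ (Lp.coeFn_const (p := 2) (μ := μ) c)] with x h1 h2 h3
  rw [h1, h2, h3, Function.const_apply, Function.const_apply]

theorem mulOp_translate_const [IsFiniteMeasure μ] (h : G) :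
    mulOp (translate h (Lp.const ∞ μ 1)) = 1 := by
  ext1 ξ
  apply Lp.ext
  filter_upwards [coeFn_mulOp (translate h (Lp.const ∞ μ 1)) ξ,
    coeFn_translate_const (μ := μ) h 1] with x h1 h2
  rw [h1, h2, one_mul, one_apply_eq_self]

variable [IsFiniteMeasure μ] [DecidableEq G]

/-- The vector `1 ⊗ δ₁` is separating for the crossed product. -/
theorem eq_smul_of_apply_vacuum_eq {T : HilbertSpace G μ →L[ℂ] HilbertSpace G μ}
    (hT : T ∈ crossedProduct μ (⊤ : Subgroup G)) {c : ℂ} (h : T (vacuum G μ) = c • vacuum G μ) :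
    T = c • ContinuousLinearMap.id ℂ _ := by
  have key (g : G) (f : Lp ℂ ∞ μ) :
      T (lp.single 2 g (mulOp f (Lp.const 2 μ 1))) =
        c • lp.single 2 g (mulOp f (Lp.const 2 μ 1)) := by
    -- The parameters are chosen so that `R Ω = f ⊗ δ_g`; since `R` commutes with `T`, the relation
    -- `T Ω = c Ω` carries over to this vector.
    obtain ⟨R, hR, -, hR'⟩ := exists_rightTranslation_mem_commutant (translate g⁻¹ f) g⁻¹
    have h1 : R (vacuum G μ) = lp.single 2 g (mulOp f (Lp.const 2 μ 1)) := by
      rw [vacuum, hR', ← translate_mul, inv_inv, mul_inv_cancel, translate_one]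
    rw [← h1]
    have := VonNeumannAlgebra.mem_commutant_iff.1 hR T hT
    calc T (R (vacuum G μ)) = R (T (vacuum G μ)) := DFunLike.congr_fun this _
      _ = _ := by rw [h, map_smul]
  have key' (g : G) (ξ : Lp ℂ 2 μ) : T (lp.single 2 g ξ) = c • lp.single 2 g ξ := by
    induction ξ using Lp.induction (p := 2) (by norm_num) with
    | indicatorConst d hs hμs =>
      have : (Lp.simpleFunc.indicatorConst 2 hs hμs.ne d : Lp ℂ 2 μ) =
          mulOp (indicatorConstLp ∞ hs hμs.ne d) (Lp.const 2 μ 1) := by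
        rw [Lp.simpleFunc.coe_indicatorConst]
        apply Lp.ext
        exact indicatorConstLp_coeFn.trans
          (indicatorConstLp_coeFn.symm.trans (coeFn_mulOp_const _).symm)
      rw [this]
      exact key g _
    | add hf hg _ h1 h2 => rw [lp.single_add, map_add, smul_add, h1, h2]
    | isClosed =>
      have := (lp.singleContinuousLinearMap ℂ (fun _ : G => Lp ℂ 2 μ) 2 g).continuous
      exact isClosed_eq (T.continuous.comp this) (this.const_smul c)
  ext1 ξ
  have hs := lp.hasSum_single (by norm_num) ξ
  refine (T.hasSum hs).unique ?_
  simp only [key']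
  exact hs.const_smul c

/-- If `S` commutes with `T`, `R` lies in the commutant of the crossed product and `S Ω = R Ω`, then
`S T Ω = R T Ω`. With `S = f ⊗ 1` this reads `f ξ_g = σ_g(f) ξ_g` for the components `ξ_g` of `T Ω`;
with `S = u_a` it yields `σ_a ξ_1 = ξ_1`. -/
theorem exists_apply_vacuum_eq_smul [StandardBorelSpace X] (hfree : EssentiallyFree G μ)
    (a : G) [ErgodicSMul (Subgroup.zpowers a) X μ]
    {T : HilbertSpace G μ →L[ℂ] HilbertSpace G μ}
    (hT : T ∈ crossedProduct μ (⊤ : Subgroup G))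
    (hT' : T ∈ (crossedProduct μ (Subgroup.zpowers a)).commutant) :
    ∃ c : ℂ, T (vacuum G μ) = c • vacuum G μ := by
  rw [mem_commutant_crossedProduct] at hT'
  have transfer {S R : HilbertSpace G μ →L[ℂ] HilbertSpace G μ} (hS : Commute S T)
      (hR : R ∈ (crossedProduct μ (⊤ : Subgroup G)).commutant)
      (h : S (vacuum G μ) = R (vacuum G μ)) : S (T (vacuum G μ)) = R (T (vacuum G μ)) := by
    have h1 : S (T (vacuum G μ)) = T (S (vacuum G μ)) := DFunLike.congr_fun hS.eq _
    have h2 : T (R (vacuum G μ)) = R (T (vacuum G μ)) :=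
      DFunLike.congr_fun (VonNeumannAlgebra.mem_commutant_iff.1 hR T hT) _
    rw [h1, h, h2]
  have hoff (g : G) (hg : g ≠ 1) : T (vacuum G μ) g = 0 := by
    refine eq_zero_of_mulOp_translate_eq (hfree g hg) fun f => ?_
    obtain ⟨R, hR, hR1, hR2⟩ := exists_rightTranslation_mem_commutant f (1 : G)
    have := transfer (hT'.1 f) hR (by
      rw [vacuum, hR2, coeff, tensorTranslation_single, mul_one, inv_one, translate_one])
    have := congrArg (fun ξ : HilbertSpace G μ => ξ g) this
    simpa [coeff, hR1] using this
  have hinv : koopman μ a (T (vacuum G μ) 1) = T (vacuum G μ) 1 := by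
    obtain ⟨R, hR, hR1, hR2⟩ := exists_rightTranslation_mem_commutant (Lp.const ∞ μ 1) a⁻¹
    have := transfer (hT'.2 a (Subgroup.mem_zpowers a)) hR (by
      rw [vacuum, hR2, canonicalUnitary, tensorTranslation_single, mul_one, inv_inv,
        koopman_const, mulOp_translate_const, one_apply_eq_self])
    -- The components at `a` are `σ_a ξ_1` on the left and `ξ_1` on the right.
    have := congrArg (fun ξ : HilbertSpace G μ => ξ a) this
    simpa [canonicalUnitary, hR1, mulOp_translate_const] using this
  have herg : Ergodic (a • · : X → X) μ := ErgodicSMul.ergodic_smul a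
  obtain ⟨c, hc⟩ := herg.ae_eq_const_of_ae_eq_comp_ae (g := T (vacuum G μ) 1)
    (Lp.aestronglyMeasurable _) (by
      have h1 := coeFn_koopman a (T (vacuum G μ) 1)
      rw [hinv] at h1
      filter_upwards [ae_smul a h1] with x hx
      rw [Function.comp_apply, hx, inv_smul_smul])
  refine ⟨c, ?_⟩
  ext1
  funext g
  by_cases hg : g = 1
  · subst hg
    rw [vacuum, lp.coeFn_smul, Pi.smul_apply, lp.single_apply_self]
    apply Lp.ext
    filter_upwards [hc, Lp.coeFn_smul c (Lp.const 2 μ (1 : ℂ)),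
      Lp.coeFn_const (p := 2) (μ := μ) (1 : ℂ)] with x h1 h2 h3
    rw [← vacuum, h1, h2, Pi.smul_apply, h3]
    simp
  · rw [hoff g hg, vacuum, lp.coeFn_smul, Pi.smul_apply, lp.single_apply_ne _ _ _ hg, smul_zero]

end IsFiniteMeasure

section IsProbabilityMeasure

variable [IsProbabilityMeasure μ]

/-- If the action is essentially free and `a` acts ergodically, then `L^∞(X) ⋊ ⟨a⟩` is
irreducible in the crossed product. -/
theorem commutant_inter_crossedProduct_eq [StandardBorelSpace X] (hfree : EssentiallyFree G μ)
    (a : G) [ErgodicSMul (Subgroup.zpowers a) X μ] :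
    ((crossedProduct μ (Subgroup.zpowers a)).commutant : Set _) ∩
      (crossedProduct μ (⊤ : Subgroup G) : Set _) =
        {T | ∃ c : ℂ, T = c • ContinuousLinearMap.id ℂ (HilbertSpace G μ)} := by
  classical
  ext T
  constructor
  · rintro ⟨h1, h2⟩
    obtain ⟨c, hc⟩ := exists_apply_vacuum_eq_smul hfree a h2 h1
    exact ⟨c, eq_smul_of_apply_vacuum_eq h2 hc⟩
  · rintro ⟨c, rfl⟩
    exact ⟨smul_id_mem_vonNeumannAlgebra _ _, smul_id_mem_vonNeumannAlgebra _ _⟩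

theorem translate_indicatorConstLp {s : Set X} (hs : MeasurableSet s) (h : G)
    (hinv : (fun x => h • x) ⁻¹' s =ᵐ[μ] s) (c : ℂ) :
    translate h (indicatorConstLp ∞ hs (measure_ne_top μ s) c) =
      indicatorConstLp ∞ hs (measure_ne_top μ s) c := by
  apply Lp.ext
  filter_upwards [coeFn_translate h (indicatorConstLp ∞ hs (measure_ne_top μ s) c),
    ae_smul h⁻¹ (indicatorConstLp_coeFn (p := ∞) (hs := hs) (hμs := measure_ne_top μ s) (c := c)),
    indicatorConstLp_coeFn (p := ∞) (hs := hs) (hμs := measure_ne_top μ s) (c := c),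
    ae_smul h⁻¹ hinv.mem_iff] with x h1 h2 h3 h4
  rw [h1, h2, h3]
  simp only [Set.mem_preimage, smul_inv_smul] at h4
  by_cases hx : x ∈ s
  · rw [Set.indicator_of_mem hx, Set.indicator_of_mem (h4.1 hx)]
  · rw [Set.indicator_of_notMem hx, Set.indicator_of_notMem (fun h' => hx (h4.2 h'))]

/-- If `L^∞(X) ⋊ L` is irreducible in the crossed product, then `L` acts ergodically. -/
theorem ergodicSMul_of_commutant_inter_subset {L : Subgroup G}
    (hL : ((crossedProduct μ L).commutant : Set _) ∩ (crossedProduct μ (⊤ : Subgroup G) : Set _) ⊆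
      {T | ∃ c : ℂ, T = c • ContinuousLinearMap.id ℂ (HilbertSpace G μ)}) :
    ErgodicSMul L X μ := by
  classical
  refine ⟨fun {s} hs hinv => ?_⟩
  set f : Lp ℂ ∞ μ := indicatorConstLp ∞ hs (measure_ne_top μ s) 1 with hf
  obtain ⟨c, hc⟩ := hL (a := coeff G f) ⟨mem_commutant_crossedProduct.2
    ⟨fun f' => commute_coeff _ _, fun h hh => by
      change _ * _ = _ * _
      rw [canonicalUnitary_mul_coeff, hf, translate_indicatorConstLp hs h (hinv ⟨h, hh⟩)]⟩,
    coeff_mem_crossedProduct f ⊤⟩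
  have h1 := congrArg (fun T => T (vacuum G μ) 1) hc
  simp only [vacuum, coeff, tensorTranslation_single, mul_one, lp.single_apply_self,
    _root_.smul_apply, ContinuousLinearMap.id_apply, lp.coeFn_smul,
    Pi.smul_apply] at h1
  have h2 : s.indicator (fun _ => (1 : ℂ)) =ᵐ[μ] fun _ => c := by
    have h3 := coeFn_mulOp_const f
    rw [h1] at h3
    filter_upwards [h3, indicatorConstLp_coeFn (p := ∞) (hs := hs) (hμs := measure_ne_top μ s)
      (c := (1 : ℂ)), Lp.coeFn_smul c (Lp.const 2 μ (1 : ℂ)),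
      Lp.coeFn_const (p := 2) (μ := μ) (1 : ℂ)] with x h3 h4 h5 h6
    rw [← h4, ← h3, h5, Pi.smul_apply, h6]
    simp
  rw [Filter.eventuallyConst_set]
  by_cases hc1 : c = 1
  · left
    filter_upwards [h2] with x hx
    by_contra hxs
    rw [Set.indicator_of_notMem hxs, hc1] at hx
    exact zero_ne_one hx
  · right
    filter_upwards [h2] with x hx hxs
    rw [Set.indicator_of_mem hxs] at hx
    exact hc1 hx.symm

/-- If `L^∞(X) ⋊ L` is irreducible in the crossed product, then every nontrivial element commuting
with `L` acts essentially freely. -/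
theorem measure_fixedBy_eq_zero_of_commutant_inter_subset [StandardBorelSpace X] {L : Subgroup G}
    (hL : ((crossedProduct μ L).commutant : Set _) ∩ (crossedProduct μ (⊤ : Subgroup G) : Set _) ⊆
      {T | ∃ c : ℂ, T = c • ContinuousLinearMap.id ℂ (HilbertSpace G μ)})
    {g : G} (hg : g ≠ 1) (hgL : ∀ h ∈ L, Commute g h) : μ (MulAction.fixedBy X g) = 0 := by
  classical
  have hs := measurableSet_fixedBy (X := X) g
  set f : Lp ℂ ∞ μ := indicatorConstLp ∞ hs (measure_ne_top μ _) 1 with hf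
  have hf1 : f =ᵐ[μ] (MulAction.fixedBy X g).indicator fun _ => 1 := indicatorConstLp_coeFn
  have hM : coeff G f * canonicalUnitary μ g ∈ (crossedProduct μ L).commutant := by
    refine mem_commutant_crossedProduct.2 ⟨fun f' => ?_, fun h hh => ?_⟩
    -- On the fixed points of `g` the functions `f'` and `σ_g f'` agree, and elsewhere `f` vanishes.
    · have h1 : coeff G f' * coeff G f = coeff G f * coeff G (translate g f') := by
        rw [coeff, coeff, coeff, tensorTranslation_mul, tensorTranslation_mul]
        congr 1
        ext1 ξ
        apply Lp.ext
        filter_upwards [coeFn_mulOp f' (mulOp f ξ), coeFn_mulOp f ξ,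
          coeFn_mulOp f (mulOp (translate g f') ξ), coeFn_mulOp (translate g f') ξ,
          coeFn_translate g f', hf1] with x h1 h2 h3 h4 h5 h6
        simp only [ContinuousLinearMap.mul_def, ContinuousLinearMap.comp_apply, h1, h2, h3, h4, h5,
          h6]
        by_cases hx : x ∈ MulAction.fixedBy X g
        · have : g⁻¹ • x = x := inv_smul_eq_iff.2 (MulAction.mem_fixedBy.1 hx).symm
          rw [this]
          ring
        · simp [Set.indicator_of_notMem hx]
      change _ * _ = _ * _
      rw [← mul_assoc, h1, mul_assoc, mul_assoc, canonicalUnitary_mul_coeff]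
    · have hinv : (fun x : X => h • x) ⁻¹' MulAction.fixedBy X g = MulAction.fixedBy X g := by
        ext x
        rw [Set.mem_preimage, MulAction.mem_fixedBy, MulAction.mem_fixedBy, smul_smul,
          (hgL h hh).eq, mul_smul, smul_left_cancel_iff]
      change _ * _ = _ * _
      rw [← mul_assoc, canonicalUnitary_mul_coeff, hf,
        translate_indicatorConstLp hs h (Filter.EventuallyEq.of_eq hinv), mul_assoc, mul_assoc,
        canonicalUnitary_mul, canonicalUnitary_mul, (hgL h hh).eq]
  obtain ⟨c, hc⟩ := hL ⟨hM, mul_mem (coeff_mem_crossedProduct f ⊤)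
    (canonicalUnitary_mem_crossedProduct (Subgroup.mem_top g))⟩
  -- At `g ≠ 1` the vector `c Ω` has component zero, while `f u_g Ω` has component `f`.
  have h1 := congrArg (fun T => T (vacuum G μ) g) hc
  simp only [vacuum, coeff, canonicalUnitary, tensorTranslation_single,
    one_mul, mul_one, lp.single_apply_self, _root_.smul_apply,
    ContinuousLinearMap.id_apply, lp.coeFn_smul, Pi.smul_apply, lp.single_apply_ne _ _ _ hg,
    smul_zero, ContinuousLinearMap.mul_def, ContinuousLinearMap.comp_apply, koopman_const] at h1
  rw [measure_eq_zero_iff_ae_notMem]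
  filter_upwards [coeFn_mulOp_const f, hf1, Lp.eq_zero_iff_ae_eq_zero.1 h1] with x h2 h3 h4 hx
  rw [← h2, h4, Set.indicator_of_mem hx] at h3
  exact zero_ne_one h3

end IsProbabilityMeasure

end CrossedProduct

theorem lemma5p1 (n m : ℤ) (hn : 2 ≤ n) (hnm : n ≤ |m|)
    {X : Type*} [MeasurableSpace X] [StandardBorelSpace X]
    (μ : Measure X) [IsProbabilityMeasure μ]
    [MulAction (BaumslagSolitar n m) X] [MeasurableConstSMul (BaumslagSolitar n m) X]
    [SMulInvariantMeasure (BaumslagSolitar n m) X μ] :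
    List.TFAE [
      ∀ z ∈ indexSet n m,
        ((CrossedProduct.crossedProduct μ
            (Subgroup.zpowers (BaumslagSolitar.a n m ^ z))).commutant : Set _) ∩
          (CrossedProduct.crossedProduct μ (⊤ : Subgroup (BaumslagSolitar n m)) : Set _) =
        {T | ∃ c : ℂ, T = c • ContinuousLinearMap.id ℂ
          (CrossedProduct.HilbertSpace (BaumslagSolitar n m) μ)},
      EssentiallyFree (quasiCentralizer (Subgroup.zpowers (BaumslagSolitar.a n m))) μ ∧
        ∀ z ∈ indexSet n m, ErgodicSMul (Subgroup.zpowers (BaumslagSolitar.a n m ^ z)) X μ,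
      EssentiallyFree (BaumslagSolitar n m) μ ∧
        ∀ z ∈ indexSet n m, ErgodicSMul (Subgroup.zpowers (BaumslagSolitar.a n m ^ z)) X μ] := by
  have hn0 : n ≠ 0 := by omega
  have hm0 : m ≠ 0 := by
    rintro rfl
    simp at hnm
    omega
  tfae_have 1 → 2 := by
    intro h
    refine ⟨fun g hg => ?_, fun z hz =>
      CrossedProduct.ergodicSMul_of_commutant_inter_subset (h z hz).subset⟩
    obtain ⟨z, hz, hc⟩ := BaumslagSolitar.exists_mem_indexSet_commute hn0 hm0 g.2
    refine CrossedProduct.measure_fixedBy_eq_zero_of_commutant_inter_subset (g := g.1)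
      (h z hz).subset (by simpa using hg) ?_
    rintro _ ⟨j, rfl⟩
    exact hc.zpow_right j
  tfae_have 2 → 3 := fun h => ⟨EssentiallyFree.of_quasiCentralizer_zpowers
    (BaumslagSolitar.commutator_mem_quasiCentralizer hn0 hm0) h.1, h.2⟩
  tfae_have 3 → 1 := by
    intro h z hz
    have := h.2 z hz
    exact CrossedProduct.commutant_inter_crossedProduct_eq h.1 _
  tfae_finish
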